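/- Let $d, M \ge 1$ be integers, let $\Omega \subset \mathbb{R}^d$ be a bounded domain (a nonempty, connected, bounded open set; in particular every bounded connected Lipschitz extension domain is allowed), let $\alpha > 0$, and let $\nu_1 < \dots < \nu_M$ be integers. For $u \in L^1(\Omega)$ let $$\mathrm{TV}(u) = \sup\Big\{ \int_\Omega u(x)\, \nabla\cdot\phi(x)\, dx \;\Big|\; \phi \in C^1_c(\Omega)^d,\ \sup_{s\in\Omega} \|\phi(s)\| \le 1 \Big\} \in [0,\infty],$$ where $\|\cdot\|$ is the Euclidean norm, and let $BV(\Omega)$ be the set of all $u \in L^1(\Omega)$ with $\mathrm{TV}(u) < \infty$. Let $\tilde v \in L^2(\Omega) \cap BV(\Omega)$ satisfy $\tilde v(x) \in \{\nu_1,\dots,\nu_M\}$ for almost all $x \in \Omega$, let $\tilde g \in L^2(\Omega)$, and let $\Delta > 0$. Then the trust-region subproblem $$\min_{v \in L^2(\Omega)} \ (\tilde g, v - \tilde v)_{L^2(\Omega)} + \alpha\,\mathrm{TV}(v) - \alpha\,\mathrm{TV}(\tilde v) \quad \text{s.t.} \quad \|v - \tilde v\|_{L^1(\Omega)} \le \Delta,\quad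 v(x) \in \{\nu_1,\dots,\nu_M\} \text{ for almost all } x \in \Omega$$ has a minimizer. -/

import Mathlib

open MeasureTheory Set
open scoped ENNReal

noncomputable section

/-- The divergence `∇ · φ` of a vector field on `ℝ^d`, as the sum of the partial derivatives
`∂ᵢ φᵢ`. -/
def divergence {d : ℕ} (φ : EuclideanSpace ℝ (Fin d) → EuclideanSpace ℝ (Fin d))
    (x : EuclideanSpace ℝ (Fin d)) : ℝ :=
  ∑ i : Fin d, (fderiv ℝ φ x (EuclideanSpace.single i 1)) i

/-- The test fields for the total variation: fields in `C¹_c(Ω)^d` (identified with their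
extension by zero to `ℝ^d`) whose Euclidean norm is bounded by one. -/
def tvTestFields {d : ℕ} (Ω : Set (EuclideanSpace ℝ (Fin d))) :
    Set (EuclideanSpace ℝ (Fin d) → EuclideanSpace ℝ (Fin d)) :=
  {φ | ContDiff ℝ 1 φ ∧ HasCompactSupport φ ∧ tsupport φ ⊆ Ω ∧ ∀ x, ‖φ x‖ ≤ 1}

/-- The total variation `TV(u) ∈ [0, ∞]` of `u ∈ L¹(Ω)`. Since the zero field is a test field,
cutting off negative values with `ENNReal.ofReal` does not change the supremum. -/
def totalVariation {d : ℕ} (Ω : Set (EuclideanSpace ℝ (Fin d)))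
    (u : EuclideanSpace ℝ (Fin d) → ℝ) : ℝ≥0∞ :=
  ⨆ φ ∈ tvTestFields Ω, ENNReal.ofReal (∫ x in Ω, u x * divergence φ x)

/-- `u ∈ BV(Ω)`: `u` is in `L¹(Ω)` and has finite total variation. -/
def MemBV {d : ℕ} (Ω : Set (EuclideanSpace ℝ (Fin d)))
    (u : EuclideanSpace ℝ (Fin d) → ℝ) : Prop :=
  IntegrableOn u Ω ∧ totalVariation Ω u < ∞

/-- The feasible set of the integer control problem: all `v ∈ L²(Ω)` such that
`v(x) ∈ {ν₁, …, ν_M}` for almost all `x ∈ Ω`. -/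
def controlFeasible {d M : ℕ} (Ω : Set (EuclideanSpace ℝ (Fin d))) (ν : Fin M → ℤ) :
    Set (Lp ℝ 2 (volume.restrict Ω)) :=
  {v | ∀ᵐ x ∂(volume.restrict Ω), ∃ i : Fin M, v x = (ν i : ℝ)}

/-- The feasible set of the trust-region subproblem: all feasible controls `v` with
`‖v - v'‖_{L¹(Ω)} ≤ Δ`. -/
def trFeasible {d M : ℕ} (Ω : Set (EuclideanSpace ℝ (Fin d))) (ν : Fin M → ℤ)
    (v' : Lp ℝ 2 (volume.restrict Ω)) (Δ : ℝ) : Set (Lp ℝ 2 (volume.restrict Ω)) :=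
  {v | eLpNorm (fun x => v x - v' x) 1 (volume.restrict Ω) ≤ ENNReal.ofReal Δ ∧
    v ∈ controlFeasible Ω ν}

/-- The objective `(g, v - v')_{L²(Ω)} + α TV(v) - α TV(v')` of the trust-region subproblem,
with values in the extended reals (`TV(v)` may be infinite). -/
def trObjective {d : ℕ} (Ω : Set (EuclideanSpace ℝ (Fin d))) (α : ℝ)
    (v' g v : Lp ℝ 2 (volume.restrict Ω)) : EReal :=
  ((inner ℝ g (v - v') : ℝ) : EReal) + (α : EReal) * (totalVariation Ω v : EReal)
    - (α : EReal) * (totalVariation Ω v' : EReal)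

end

/-! The proof is the direct method. Feasible controls take finitely many values, so they are bounded
by some `B`, and their `L²` norms are bounded on the bounded set `Ω`. Hence the linear term is
bounded, and a competitor with `TV` above a suitable `C` is no better than the feasible point `v'`.
It remains to minimize over controls with `TV ≤ C`. There the objective is lower semicontinuous,
since `TV` is a supremum of continuous functionals, and the constraints are closed.

The substance is `isCompact_bvBall`: compactness in `L²` without regularity of the boundary.
Integrating a test function along the segment from `x - h` to `x` gives an admissible field whose
divergence is a multiple of `φ x - φ (x - h)`. By duality, a bound on `TV` controls `L¹` translation
differences on compact sets (`setIntegral_abs_sub_translate_le`), hence the distance to ball means.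
Along a weakly convergent subsequence the ball means converge pointwise, so the functions are Cauchy
in `L¹` of every compact subset (`exists_setIntegral_abs_sub_le`). The part of `Ω` near the boundary
has small measure, and there the bound `B` suffices (`norm_sub_sq_le`). -/

/-! ### Averages of a test function along a segment -/

section SegmentIntegral

open scoped Convolution Topology

variable {E : Type*} [NormedAddCommGroup E] [NormedSpace ℝ E]

/-- The integral of `φ` over the segment from `x - h` to `x`, parametrized by `[0, 1]`. -/
noncomputable def segmentIntegral (h : E) (φ : E → ℝ) (x : E) : ℝ :=
  ∫ t in Icc (0 : ℝ) 1, φ (x - t • h)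

lemma norm_segmentIntegral_le (h : E) {φ : E → ℝ} (hφ : ∀ x, |φ x| ≤ 1) (x : E) :
    ‖segmentIntegral h φ x‖ ≤ 1 := by
  have := norm_setIntegral_le_of_norm_le_const (μ := volume) (s := Icc (0 : ℝ) 1) (C := 1)
    (f := fun t => φ (x - t • h)) (by simp) (fun t _ => hφ _)
  simpa [segmentIntegral] using this

lemma support_segmentIntegral_subset {h : E} {φ : E → ℝ} {A : Set E} {r : ℝ}
    (hA : Function.support φ ⊆ A) (hr : ‖h‖ ≤ r) :
    Function.support (segmentIntegral h φ) ⊆ Metric.cthickening r A := by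
  intro x hx
  by_contra hxA
  refine hx (setIntegral_eq_zero_of_forall_eq_zero fun t ht => ?_)
  by_contra hne
  refine hxA (Metric.mem_cthickening_of_dist_le x (x - t • h) r A (hA hne) ?_)
  rw [dist_eq_norm, sub_sub_cancel, norm_smul, Real.norm_of_nonneg ht.1]
  exact (mul_le_of_le_one_left (norm_nonneg _) ht.2).trans hr

variable [MeasurableSpace E] [BorelSpace E]

/-- The push-forward of Lebesgue measure on `[0, 1]` to the segment from `0` to `h`. -/
noncomputable def segmentMeasure (h : E) : Measure E :=
  Measure.map (fun t : ℝ => t • h) (volume.restrict (Icc 0 1))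

instance (h : E) : IsFiniteMeasure (segmentMeasure h) := by
  unfold segmentMeasure; infer_instance

lemma integral_segmentMeasure (h : E) {φ : E → ℝ} (hφ : Continuous φ) :
    ∫ y, φ y ∂(segmentMeasure h) = ∫ t in Icc (0 : ℝ) 1, φ (t • h) :=
  integral_map (by fun_prop) hφ.aestronglyMeasurable

/-- This form makes `C¹` regularity a consequence of the smoothness of convolutions. -/
lemma segmentIntegral_eq_convolution (h : E) {φ : E → ℝ} (hφ : Continuous φ) :
    segmentIntegral h φ =
      (fun _ => (1 : ℝ)) ⋆[ContinuousLinearMap.lsmul ℝ ℝ, segmentMeasure h] φ := by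
  ext x
  simp only [convolution_def, ContinuousLinearMap.lsmul_apply, one_smul, segmentIntegral]
  rw [integral_segmentMeasure h (φ := fun y => φ (x - y)) (by fun_prop)]

lemma contDiff_segmentIntegral (h : E) {φ : E → ℝ} (hφ : ContDiff ℝ 1 φ)
    (hc : HasCompactSupport φ) : ContDiff ℝ 1 (segmentIntegral h φ) := by
  rw [segmentIntegral_eq_convolution h hφ.continuous]
  exact hc.contDiff_convolution_right (n := 1) _ (integrable_const (1 : ℝ)).locallyIntegrable hφ

lemma fderiv_segmentIntegral_apply (h : E) {φ : E → ℝ} (hφ : ContDiff ℝ 1 φ)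
    (hc : HasCompactSupport φ) (x : E) :
    fderiv ℝ (segmentIntegral h φ) x h = φ x - φ (x - h) := by
  have hΦ : HasFDerivAt (segmentIntegral h φ) (fderiv ℝ (segmentIntegral h φ) x)
      (x + (0 : ℝ) • h) := by
    simpa using ((contDiff_segmentIntegral h hφ hc).differentiable one_ne_zero x).hasFDerivAt
  have hline : HasDerivAt (fun s : ℝ => x + s • h) h 0 := by
    simpa using ((hasDerivAt_id (0 : ℝ)).smul_const h).const_add x
  have h1 := hΦ.comp_hasDerivAt (0 : ℝ) hline
  have hg : Continuous fun t : ℝ => φ (x - t • h) := by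
    have := hφ.continuous
    fun_prop
  -- Moving `x` along `h` only shifts the parameter window to `[-s, 1 - s]`, so the derivative at `s
  -- = 0` is a difference of endpoint values.
  have hshift : ∀ s : ℝ, segmentIntegral h φ (x + s • h) =
      (∫ t in (0 : ℝ)..(1 - s), φ (x - t • h)) - ∫ t in (0 : ℝ)..(0 - s), φ (x - t • h) := by
    intro s
    rw [intervalIntegral.integral_interval_sub_left (hg.intervalIntegrable _ _)
      (hg.intervalIntegrable _ _), ← intervalIntegral.integral_comp_sub_right, segmentIntegral,
      integral_Icc_eq_integral_Ioc, ← intervalIntegral.integral_of_le zero_le_one]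
    congr 1
    ext t
    congr 1
    module
  have hprim : ∀ a : ℝ, HasDerivAt (fun s : ℝ => ∫ t in (0 : ℝ)..(a - s), φ (x - t • h))
      (-φ (x - a • h)) 0 := by
    intro a
    have h2 := (hg.integral_hasStrictDerivAt 0 (a - 0)).hasDerivAt.comp_const_sub a 0
    simpa using h2
  have h3 := (hprim 1).sub (hprim 0)
  simp_rw [Function.comp_def, hshift] at h1
  rw [h1.unique h3]
  simp
  ring

end SegmentIntegral

/-! ### Testing the total variation with segment averages -/

section TotalVariation

variable {d : ℕ} {Ω : Set (EuclideanSpace ℝ (Fin d))} {u : EuclideanSpace ℝ (Fin d) → ℝ}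

lemma integral_mul_divergence_le {C : ℝ} (hC : 0 ≤ C)
    (hu : totalVariation Ω u ≤ ENNReal.ofReal C)
    {ψ : EuclideanSpace ℝ (Fin d) → EuclideanSpace ℝ (Fin d)} (hψ : ψ ∈ tvTestFields Ω) :
    ∫ x in Ω, u x * divergence ψ x ≤ C := by
  rw [← ENNReal.ofReal_le_ofReal_iff hC]
  exact (le_iSup₂ (f := fun φ (_ : φ ∈ tvTestFields Ω) =>
    ENNReal.ofReal (∫ x in Ω, u x * divergence φ x)) ψ hψ).trans hu

lemma divergence_smul_const {f : EuclideanSpace ℝ (Fin d) → ℝ}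
    (hf : Differentiable ℝ f) (h x : EuclideanSpace ℝ (Fin d)) :
    divergence (fun y => f y • h) x = fderiv ℝ f x h := by
  have h1 : fderiv ℝ (fun y => f y • h) x = (fderiv ℝ f x).smulRight h :=
    ((hf x).hasFDerivAt.smul_const h).fderiv
  unfold divergence
  rw [h1]
  conv_rhs => rw [← (EuclideanSpace.basisFun (Fin d) ℝ).sum_repr h, map_sum]
  refine Finset.sum_congr rfl fun i _ => ?_
  simp [mul_comm]

/-- The difference of a test function and its translate, integrated against a function of bounded
variation, is controlled by the length of the translation. -/
lemma integral_mul_sub_translate_le {C r : ℝ} (hC : 0 ≤ C)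
    (hu : totalVariation Ω u ≤ ENNReal.ofReal C) (hr : 0 < r)
    {A : Set (EuclideanSpace ℝ (Fin d))} (hA : IsCompact A) (hAΩ : Metric.cthickening r A ⊆ Ω)
    {φ : EuclideanSpace ℝ (Fin d) → ℝ} (hφ : ContDiff ℝ 1 φ) (hφA : Function.support φ ⊆ A)
    (hφ1 : ∀ x, |φ x| ≤ 1) {h : EuclideanSpace ℝ (Fin d)} (hh : ‖h‖ ≤ r) :
    ∫ x in Ω, u x * (φ x - φ (x - h)) ≤ r * C := by
  have hc : HasCompactSupport φ := HasCompactSupport.of_support_subset_isCompact hA hφA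
  have hS := contDiff_segmentIntegral h hφ hc
  have hsupp : tsupport (fun x => segmentIntegral h φ x • (r⁻¹ • h)) ⊆ Metric.cthickening r A := by
    refine closure_minimal ?_ Metric.isClosed_cthickening
    exact (Function.support_smul_subset_left _ _).trans (support_segmentIntegral_subset hφA hh)
  -- Scaling by `r⁻¹` rather than `‖h‖⁻¹` gives norm at most one and covers `h = 0`.
  have hψ : (fun x => segmentIntegral h φ x • (r⁻¹ • h)) ∈ tvTestFields Ω := by
    refine ⟨hS.smul contDiff_const, ?_, hsupp.trans hAΩ, fun x => ?_⟩
    · exact hA.cthickening.of_isClosed_subset (isClosed_tsupport _) hsupp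
    · rw [norm_smul, norm_smul, Real.norm_of_nonneg (inv_nonneg.2 hr.le)]
      refine mul_le_one₀ (norm_segmentIntegral_le h hφ1 x) (by positivity) ?_
      rw [inv_mul_le_iff₀ hr]
      simpa using hh
  have := integral_mul_divergence_le hC hu hψ
  have heq : ∀ x, u x * divergence (fun x => segmentIntegral h φ x • (r⁻¹ • h)) x
      = r⁻¹ * (u x * (φ x - φ (x - h))) := fun x => by
    rw [divergence_smul_const (hS.differentiable one_ne_zero), map_smul,
      fderiv_segmentIntegral_apply h hφ hc, smul_eq_mul]
    ring
  simp_rw [heq] at this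
  rwa [integral_const_mul, inv_mul_le_iff₀ hr] at this

end TotalVariation

/-! ### Mollification of bounded, compactly supported functions -/

section SmoothApproximation

open scoped Convolution Topology
open Filter

variable {E : Type*} [NormedAddCommGroup E] [InnerProductSpace ℝ E] [FiniteDimensional ℝ E]
  [MeasurableSpace E] [BorelSpace E]

/-- A measurable function with values in `[-1, 1]` and support in a compact set is the almost
everywhere limit of smooth functions with values in `[-1, 1]` supported near this set. -/
lemma exists_contDiff_ae_tendsto {s : E → ℝ} {K : Set E} {r : ℝ} (hs : Measurable s)
    (hs1 : ∀ x, |s x| ≤ 1) (hK : IsCompact K) (hsK : Function.support s ⊆ K) (hr : 0 < r) :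
    ∃ φ : ℕ → E → ℝ, (∀ n, ContDiff ℝ 1 (φ n)) ∧ (∀ n x, |φ n x| ≤ 1) ∧
      (∀ n, Function.support (φ n) ⊆ Metric.cthickening r K) ∧
      ∀ᵐ x, Tendsto (fun n => φ n x) atTop (𝓝 (s x)) := by
  have hint : Integrable s := by
    refine (integrableOn_iff_integrable_of_support_subset hsK).1 ?_
    exact Measure.integrableOn_of_bounded hK.measure_lt_top.ne hs.aestronglyMeasurable
      (ae_of_all _ hs1)
  have hpos : ∀ n : ℕ, 0 < r / (n + 1) := fun n => by positivity
  let b : ℕ → ContDiffBump (0 : E) := fun n =>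
    { rIn := r / (n + 1) / 2
      rOut := r / (n + 1)
      rIn_pos := half_pos (hpos n)
      rIn_lt_rOut := half_lt_self (hpos n) }
  have hle : ∀ n : ℕ, r / (n + 1) ≤ r := fun n =>
    div_le_self hr.le (by linarith [(Nat.cast_nonneg n : (0 : ℝ) ≤ n)])
  refine ⟨fun n => (b n).normed volume ⋆[ContinuousLinearMap.lsmul ℝ ℝ, volume] s,
    fun n => ?_, fun n x => ?_, fun n => ?_, ?_⟩
  · exact (b n).hasCompactSupport_normed.contDiff_convolution_left (n := 1) _
      (b n).contDiff_normed hint.locallyIntegrable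
  · have := dist_convolution_le (f := (b n).normed volume) (g := s) (x₀ := x) (z₀ := 0)
      (μ := volume) zero_le_one (b n).support_normed_eq.subset (b n).nonneg_normed
      (b n).integral_normed hs.aestronglyMeasurable (fun y _ => by simpa using hs1 y)
    simpa using this
  · refine (support_convolution_subset _).trans ?_
    rintro _ ⟨y, hy, z, hz, rfl⟩
    rw [(b n).support_normed_eq, mem_ball_zero_iff] at hy
    refine Metric.mem_cthickening_of_dist_le _ z r K (hsK hz) ?_
    rw [dist_eq_norm, add_sub_cancel_right]
    exact hy.le.trans (hle n)
  · refine ContDiffBump.ae_convolution_tendsto_right_of_locallyIntegrable (K := 2) ?_ ?_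
      hint.locallyIntegrable
    · simpa [b, div_eq_mul_inv] using
        (tendsto_one_div_add_atTop_nhds_zero_nat (𝕜 := ℝ)).const_mul r
    · exact Eventually.of_forall fun n => by simp only [b]; linarith

end SmoothApproximation

/-! ### Translation estimates and ball means -/

section Translation

open Filter
open scoped Topology

variable {d : ℕ} {Ω : Set (EuclideanSpace ℝ (Fin d))} {u : EuclideanSpace ℝ (Fin d) → ℝ}
  {B C r : ℝ} {K : Set (EuclideanSpace ℝ (Fin d))}

lemma integrable_mul_of_support_subset {w φ : EuclideanSpace ℝ (Fin d) → ℝ}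
    (hw : Measurable w) (hwB : ∀ x, |w x| ≤ B)
    (hφ : Measurable φ) (hφ1 : ∀ x, |φ x| ≤ 1) (hK : IsCompact K)
    (hφK : Function.support φ ⊆ K) : Integrable (fun x => w x * φ x) := by
  refine (integrableOn_iff_integrable_of_support_subset
    ((Function.support_mul_subset_right w φ).trans hφK)).1 ?_
  refine Measure.integrableOn_of_bounded (M := B) hK.measure_lt_top.ne
    (hw.mul hφ).aestronglyMeasurable (ae_of_all _ fun x => ?_)
  rw [norm_mul]
  exact (mul_le_of_le_one_right (norm_nonneg _) (hφ1 x)).trans (hwB x)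

/-- A change of variables moves the translation from `u` to `φ`. Both `φ` and its translate vanish
off the `r`-thickening of `K`, so values of `u` outside `Ω` do not matter. -/
lemma integral_translate_sub_mul_le (hC : 0 ≤ C) (hu : Measurable u) (huB : ∀ x, |u x| ≤ B)
    (huC : totalVariation Ω u ≤ ENNReal.ofReal C) (hr : 0 < r)
    (hK : IsCompact K) (hKΩ : Metric.cthickening r K ⊆ Ω)
    {φ : EuclideanSpace ℝ (Fin d) → ℝ} (hφ : ContDiff ℝ 1 φ) (hφK : Function.support φ ⊆ K)
    (hφ1 : ∀ x, |φ x| ≤ 1) {h : EuclideanSpace ℝ (Fin d)} (hh : ‖h‖ ≤ r) :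
    ∫ x, (u x - u (x + h)) * φ x ≤ r * C := by
  have hφm : Measurable φ := hφ.continuous.measurable
  have h1 : Integrable (fun x => u x * φ x) :=
    integrable_mul_of_support_subset hu huB hφm hφ1 hK hφK
  have h2 : Integrable (fun x => u (x + h) * φ x) :=
    integrable_mul_of_support_subset (hu.comp (measurable_add_const h)) (fun x => huB _)
      hφm hφ1 hK hφK
  have h3 : Integrable (fun x => u x * φ (x - h)) := by
    simpa using h2.comp_sub_right h
  have hsupp : Function.support (fun x => u x * (φ x - φ (x - h))) ⊆ Ω := by
    refine Set.Subset.trans (fun x hx => ?_) hKΩ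
    by_contra hxK
    refine hx ?_
    have e1 : φ x = 0 := by
      by_contra hne
      exact hxK (Metric.self_subset_cthickening _ (hφK hne))
    have e2 : φ (x - h) = 0 := by
      by_contra hne
      exact hxK (Metric.mem_cthickening_of_dist_le x (x - h) r K (hφK hne)
        (by rwa [dist_eq_norm, sub_sub_cancel]))
    simp [e1, e2]
  refine le_trans (le_of_eq ?_)
    (integral_mul_sub_translate_le hC huC hr hK hKΩ hφ hφK hφ1 hh)
  rw [setIntegral_eq_integral_of_forall_compl_eq_zero
    (fun x hx => by by_contra hne; exact hx (hsupp hne))]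
  simp_rw [sub_mul, mul_sub]
  rw [integral_sub h1 h2, integral_sub h1 h3]
  congr 1
  simpa using integral_sub_right_eq_self (μ := volume) (fun x => u x * φ (x - h)) (-h)

/-- Translations of functions of bounded variation are Lipschitz in `L¹` of compact subsets. -/
lemma setIntegral_abs_sub_translate_le (hC : 0 ≤ C) (hu : Measurable u) (huB : ∀ x, |u x| ≤ B)
    (huC : totalVariation Ω u ≤ ENNReal.ofReal C) (hr : 0 < r)
    (hK : IsCompact K) (hKΩ : Metric.cthickening (r + r) K ⊆ Ω)
    {h : EuclideanSpace ℝ (Fin d)} (hh : ‖h‖ ≤ r) :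
    ∫ x in K, |u x - u (x + h)| ≤ r * C := by
  set w : EuclideanSpace ℝ (Fin d) → ℝ := fun x => u x - u (x + h) with hw
  have hwm : Measurable w := hu.sub (hu.comp (measurable_add_const h))
  have hwB : ∀ x, |w x| ≤ B + B := fun x =>
    (abs_sub _ _).trans (add_le_add (huB _) (huB _))
  -- The sign of `w` on `K` turns `|w|` into a pairing `w * s`; `s` is then replaced by smooth
  -- approximations.
  let s : EuclideanSpace ℝ (Fin d) → ℝ := K.indicator fun x => if 0 ≤ w x then 1 else -1
  have hsm : Measurable s :=
    (Measurable.ite (measurableSet_le measurable_const hwm) measurable_const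
      measurable_const).indicator hK.measurableSet
  have hs1 : ∀ x, |s x| ≤ 1 := fun x => by
    simp only [s, indicator]
    split_ifs <;> simp
  obtain ⟨φ, hφ, hφ1, hφK, hlim⟩ :=
    exists_contDiff_ae_tendsto hsm hs1 hK support_indicator_subset hr
  have hKc : IsCompact (Metric.cthickening r K) := hK.cthickening
  -- One `r` is spent on mollifying `s`, the other on translating.
  have hsub : Metric.cthickening r (Metric.cthickening r K) ⊆ Ω :=
    (Metric.cthickening_cthickening_subset hr.le hr.le K).trans hKΩ
  have hlim' : Tendsto (fun n => ∫ x, w x * φ n x) atTop (𝓝 (∫ x, w x * s x)) := by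
    refine tendsto_integral_of_dominated_convergence
      ((Metric.cthickening r K).indicator fun _ => B + B)
      (fun n => (hwm.mul (hφ n).continuous.measurable).aestronglyMeasurable) ?_
      (fun n => ae_of_all _ fun x => ?_) (hlim.mono fun x hx => hx.const_mul _)
    · exact (integrable_indicator_iff hKc.measurableSet).2
        (integrableOn_const hKc.measure_lt_top.ne)
    · by_cases hx : x ∈ Metric.cthickening r K
      · rw [indicator_of_mem hx, norm_mul]
        exact (mul_le_of_le_one_right (norm_nonneg _) (hφ1 n x)).trans (hwB x)
      · have : φ n x = 0 := by
          by_contra hne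
          exact hx (hφK n hne)
        simp [indicator_of_notMem hx, this]
  have heq : ∫ x in K, |w x| = ∫ x, w x * s x := by
    rw [← integral_indicator hK.measurableSet]
    refine integral_congr_ae (ae_of_all _ fun x => ?_)
    by_cases hx : x ∈ K
    · simp only [s, indicator_of_mem hx]
      split_ifs with h0
      · simp [abs_of_nonneg h0]
      · simp [abs_of_neg (not_le.1 h0)]
    · simp [s, indicator_of_notMem hx]
  rw [heq]
  exact le_of_tendsto' hlim' fun n =>
    integral_translate_sub_mul_le hC hu huB huC hr hKc hsub (hφ n) (hφK n) (hφ1 n) hh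

/-- The mean of `u` over the ball of radius `r` around `x`. -/
noncomputable def ballMean (r : ℝ) (u : EuclideanSpace ℝ (Fin d) → ℝ)
    (x : EuclideanSpace ℝ (Fin d)) : ℝ :=
  ⨍ y in Metric.ball 0 r, u (x + y)

lemma isFiniteMeasure_restrict_ball :
    IsFiniteMeasure (volume.restrict (Metric.ball (0 : EuclideanSpace ℝ (Fin d)) r)) :=
  ⟨by simpa using measure_ball_lt_top⟩

lemma ballMean_measurable (hu : Measurable u) : Measurable (ballMean r u) := by
  unfold ballMean
  simp_rw [setAverage_eq]
  have := isFiniteMeasure_restrict_ball (d := d) (r := r)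
  have h : StronglyMeasurable (fun p : EuclideanSpace ℝ (Fin d) × EuclideanSpace ℝ (Fin d) =>
    u (p.1 + p.2)) := (hu.comp (measurable_fst.add measurable_snd)).stronglyMeasurable
  exact h.integral_prod_right'.measurable.const_mul _

/-- A function of bounded variation is close to its means over small balls, in `L¹` of compact
subsets. -/
lemma setIntegral_abs_sub_ballMean_le (hC : 0 ≤ C) (hu : Measurable u) (huB : ∀ x, |u x| ≤ B)
    (huC : totalVariation Ω u ≤ ENNReal.ofReal C) (hr : 0 < r)
    (hK : IsCompact K) (hKΩ : Metric.cthickening (r + r) K ⊆ Ω) :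
    ∫ x in K, |u x - ballMean r u x| ≤ r * C := by
  -- With the ball mean as an expectation under `P`, Fubini reduces the claim to an average of
  -- translation estimates with `‖y‖ ≤ r`.
  let P : Measure (EuclideanSpace ℝ (Fin d)) :=
    (volume (Metric.ball (0 : EuclideanSpace ℝ (Fin d)) r))⁻¹ • volume.restrict (Metric.ball 0 r)
  have hPm : ∀ f : EuclideanSpace ℝ (Fin d) → ℝ, ⨍ y in Metric.ball 0 r, f y = ∫ y, f y ∂P := by
    intro f
    rw [average, Measure.restrict_apply_univ]
  have : IsProbabilityMeasure P := by
    refine ⟨?_⟩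
    simp only [P, Measure.smul_apply, Measure.restrict_apply_univ, smul_eq_mul]
    exact ENNReal.inv_mul_cancel (Metric.measure_ball_pos volume _ hr).ne' measure_ball_lt_top.ne
  have : IsFiniteMeasure (volume.restrict K) := ⟨by simpa using hK.measure_lt_top⟩
  have hPb : ∀ᵐ y ∂P, ‖y‖ ≤ r := by
    refine Measure.ae_smul_measure ?_ _
    filter_upwards [ae_restrict_mem Metric.isOpen_ball.measurableSet] with y hy
    exact (mem_ball_zero_iff.1 hy).le
  have hm : Measurable (fun p : EuclideanSpace ℝ (Fin d) × EuclideanSpace ℝ (Fin d) =>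
      |u p.1 - u (p.1 + p.2)|) :=
    ((hu.comp measurable_fst).sub (hu.comp (measurable_fst.add measurable_snd))).abs
  have hb : ∀ x y, |u x - u (x + y)| ≤ B + B := fun x y =>
    (abs_sub _ _).trans (add_le_add (huB _) (huB _))
  have hint : Integrable (fun p : EuclideanSpace ℝ (Fin d) × EuclideanSpace ℝ (Fin d) =>
      |u p.1 - u (p.1 + p.2)|) ((volume.restrict K).prod P) :=
    Integrable.of_bound hm.aestronglyMeasurable (B + B) (ae_of_all _ fun p => by
      simpa using hb p.1 p.2)
  have hux : ∀ x, Integrable (fun y => u (x + y)) P := fun x =>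
    Integrable.of_bound (hu.comp (measurable_const_add x)).aestronglyMeasurable B
      (ae_of_all _ fun y => huB _)
  calc ∫ x in K, |u x - ballMean r u x|
      ≤ ∫ x in K, ∫ y, |u x - u (x + y)| ∂P := by
        refine integral_mono_of_nonneg (ae_of_all _ fun x => abs_nonneg _)
          hint.integral_prod_left (ae_of_all _ fun x => ?_)
        have : u x - ballMean r u x = ∫ y, (u x - u (x + y)) ∂P := by
          rw [integral_sub (integrable_const _) (hux x), integral_const, ballMean, hPm]
          simp
        simp only [this]
        exact abs_integral_le_integral_abs
    _ = ∫ y, (∫ x in K, |u x - u (x + y)|) ∂P := integral_integral_swap (f := fun x y => |u x - u (x + y)|) hint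
    _ ≤ ∫ _, r * C ∂P := by
        have hR : Integrable (fun y => ∫ x in K, |u x - u (x + y)|) P := hint.integral_prod_right
        refine integral_mono_ae hR (integrable_const _) ?_
        filter_upwards [hPb] with y hy
        exact setIntegral_abs_sub_translate_le hC hu huB huC hr hK hKΩ hy
    _ = r * C := by simp

lemma abs_ballMean_le (hr : 0 < r) (huB : ∀ x, |u x| ≤ B) (x : EuclideanSpace ℝ (Fin d)) :
    |ballMean r u x| ≤ B := by
  unfold ballMean
  rw [setAverage_eq, smul_eq_mul, abs_mul, abs_of_nonneg (by positivity)]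
  have h0 : 0 < volume.real (Metric.ball (0 : EuclideanSpace ℝ (Fin d)) r) :=
    ENNReal.toReal_pos (Metric.measure_ball_pos volume _ hr).ne' measure_ball_lt_top.ne
  rw [inv_mul_le_iff₀ h0, mul_comm]
  exact norm_setIntegral_le_of_norm_le_const (f := fun y => u (x + y)) measure_ball_lt_top
    fun y _ => huB _

end Translation

/-! ### Weak sequential compactness -/

section WeakCompactness

open Filter
open scoped Topology

/-- Bounded sequences in a separable Hilbert space have subsequences along which all inner products
converge. -/
lemma exists_subseq_tendsto_inner {H : Type*} [NormedAddCommGroup H] [InnerProductSpace ℝ H]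
    [CompleteSpace H] [TopologicalSpace.SeparableSpace H] {x : ℕ → H} {R : ℝ}
    (hx : ∀ n, ‖x n‖ ≤ R) :
    ∃ k : ℕ → ℕ, StrictMono k ∧
      ∀ y, ∃ l : ℝ, Tendsto (fun n => inner ℝ (x (k n)) y) atTop (𝓝 l) := by
  -- Riesz representation moves the sequence to the dual, where sequential Banach–Alaoglu applies.
  let f : ℕ → WeakDual ℝ H := fun n => StrongDual.toWeakDual (InnerProductSpace.toDual ℝ H (x n))
  have hf : ∀ n, f n ∈ WeakDual.toStrongDual ⁻¹' Metric.closedBall (0 : StrongDual ℝ H) R := by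
    intro n
    simpa [f] using hx n
  obtain ⟨a, -, k, hk, hlim⟩ := WeakDual.isSeqCompact_closedBall ℝ H 0 R hf
  refine ⟨k, hk, fun y => ⟨a y, ?_⟩⟩
  exact ((WeakDual.eval_continuous y).tendsto a).comp hlim

end WeakCompactness

/-! ### Closedness of pointwise and norm constraints in `L²` -/

section LpClosed

open Filter
open scoped Topology

variable {α : Type*} {m : MeasurableSpace α} {μ : Measure α}

lemma exists_subseq_ae_tendsto_of_tendsto_Lp {v : ℕ → Lp ℝ 2 μ} {w : Lp ℝ 2 μ}
    (h : Tendsto v atTop (𝓝 w)) :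
    ∃ k : ℕ → ℕ, StrictMono k ∧ ∀ᵐ x ∂μ, Tendsto (fun n => v (k n) x) atTop (𝓝 (w x)) :=
  (tendstoInMeasure_of_tendsto_Lp h).exists_seq_tendsto_ae

lemma isClosed_setOf_ae_mem {T : Set ℝ} (hT : IsClosed T) :
    IsClosed {v : Lp ℝ 2 μ | ∀ᵐ x ∂μ, v x ∈ T} := by
  refine IsSeqClosed.isClosed fun v w hv hw => ?_
  obtain ⟨k, -, hk⟩ := exists_subseq_ae_tendsto_of_tendsto_Lp hw
  filter_upwards [hk, ae_all_iff.2 hv] with x hx hxT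
  exact hT.mem_of_tendsto hx (Eventually.of_forall fun n => hxT _)

lemma isClosed_setOf_eLpNorm_sub_le (p : ℝ≥0∞) (v' : Lp ℝ 2 μ) (c : ℝ≥0∞) :
    IsClosed {v : Lp ℝ 2 μ | eLpNorm (fun x => v x - v' x) p μ ≤ c} := by
  refine IsSeqClosed.isClosed fun v w hv hw => ?_
  obtain ⟨k, -, hk⟩ := exists_subseq_ae_tendsto_of_tendsto_Lp hw
  refine (Lp.eLpNorm_lim_le_liminf_eLpNorm
    (f := fun n x => v (k n) x - v' x) (fun n => ?_) _ ?_).trans ?_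
  · exact ((Lp.stronglyMeasurable _).sub (Lp.stronglyMeasurable _)).aestronglyMeasurable
  · exact hk.mono fun x hx => hx.sub_const _
  · exact liminf_le_of_frequently_le' (Frequently.of_forall fun n => hv (k n))

end LpClosed

/-! ### Semicontinuity of `TV` and compactness in `L²` -/

section BoundedVariation

open Filter
open scoped Topology

variable {d : ℕ} {Ω : Set (EuclideanSpace ℝ (Fin d))} {B C : ℝ}

lemma totalVariation_congr {u v : EuclideanSpace ℝ (Fin d) → ℝ}
    (h : u =ᵐ[volume.restrict Ω] v) : totalVariation Ω u = totalVariation Ω v := by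
  have heq : ∀ φ, ∫ x in Ω, u x * divergence φ x = ∫ x in Ω, v x * divergence φ x :=
    fun φ => integral_congr_ae (h.mul (ae_eq_refl (divergence φ)))
  simp_rw [totalVariation, heq]

lemma memLp_divergence {φ : EuclideanSpace ℝ (Fin d) → EuclideanSpace ℝ (Fin d)}
    (hφ : φ ∈ tvTestFields Ω) : MemLp (divergence φ) 2 (volume.restrict Ω) := by
  have hcont : Continuous (divergence φ) := by
    have := hφ.1.continuous_fderiv one_ne_zero
    unfold divergence
    fun_prop
  have hsupp : HasCompactSupport (divergence φ) :=
    (hφ.2.1.fderiv ℝ).comp_left (g := fun A : EuclideanSpace ℝ (Fin d) →L[ℝ]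
      EuclideanSpace ℝ (Fin d) => ∑ i : Fin d, (A (EuclideanSpace.single i 1)) i) (by simp)
  exact (hcont.memLp_of_hasCompactSupport hsupp).restrict Ω

/-- The total variation is lower semicontinuous on `L²`. -/
lemma lowerSemicontinuous_totalVariation :
    LowerSemicontinuous fun v : Lp ℝ 2 (volume.restrict Ω) => totalVariation Ω v := by
  unfold totalVariation
  refine lowerSemicontinuous_biSup fun φ hφ => ?_
  refine Continuous.lowerSemicontinuous (ENNReal.continuous_ofReal.comp ?_)
  have heq : (fun v : Lp ℝ 2 (volume.restrict Ω) => ∫ x in Ω, v x * divergence φ x) =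
      fun v => inner ℝ (memLp_divergence hφ).toLp v := by
    ext v
    rw [L2.inner_def]
    refine integral_congr_ae ?_
    filter_upwards [(memLp_divergence hφ).coeFn_toLp] with x hx
    simp [hx]
  rw [heq]
  fun_prop

/-- The functions on `Ω` that are bounded by `B` and whose total variation is bounded by `C`. -/
def bvBall (Ω : Set (EuclideanSpace ℝ (Fin d))) (B C : ℝ) : Set (Lp ℝ 2 (volume.restrict Ω)) :=
  {v | (∀ᵐ x ∂(volume.restrict Ω), v x ∈ Icc (-B) B) ∧ totalVariation Ω v ≤ ENNReal.ofReal C}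

lemma isClosed_bvBall : IsClosed (bvBall Ω B C) :=
  (isClosed_setOf_ae_mem isClosed_Icc).inter
    (lowerSemicontinuous_totalVariation.isClosed_preimage (ENNReal.ofReal C))

/-- Translates see values outside `Ω`, where an element of `Lp` is uncontrolled; truncating at `±B`
gives a bound everywhere. -/
lemma exists_measurable_representative {v : Lp ℝ 2 (volume.restrict Ω)} (hB : 0 ≤ B)
    (hv : v ∈ bvBall Ω B C) : ∃ u : EuclideanSpace ℝ (Fin d) → ℝ, Measurable u ∧
      (∀ x, |u x| ≤ B) ∧ totalVariation Ω u ≤ ENNReal.ofReal C ∧ u =ᵐ[volume.restrict Ω] v := by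
  have hae : (fun x => max (-B) (min B (v x))) =ᵐ[volume.restrict Ω] v := by
    filter_upwards [hv.1] with x hx
    rw [min_eq_right hx.2, max_eq_right hx.1]
  refine ⟨fun x => max (-B) (min B (v x)), ?_, fun x => ?_, ?_, hae⟩
  · exact measurable_const.max (measurable_const.min (Lp.stronglyMeasurable v).measurable)
  · exact abs_le.2 ⟨le_max_left _ _, max_le (by linarith) (min_le_left _ _)⟩
  · rw [totalVariation_congr hae]
    exact hv.2

/-- This writes ball means as pairings with an indicator, so that weak convergence applies to them.
-/
lemma ballMean_eq_setIntegral {r : ℝ} {x : EuclideanSpace ℝ (Fin d)} (hx : Metric.ball x r ⊆ Ω)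
    {u v : EuclideanSpace ℝ (Fin d) → ℝ} (h : u =ᵐ[volume.restrict Ω] v) :
    ballMean r u x = (volume.real (Metric.ball (0 : EuclideanSpace ℝ (Fin d)) r))⁻¹ *
      ∫ y in Metric.ball x r, v y ∂(volume.restrict Ω) := by
  have hpre : (fun y => x + y) ⁻¹' Metric.ball x r = Metric.ball 0 r := by
    ext y
    simp
  have h1 := (measurePreserving_add_left volume x).setIntegral_preimage_emb
    (measurableEmbedding_addLeft x) u (Metric.ball x r)
  rw [hpre] at h1
  rw [ballMean, setAverage_eq, smul_eq_mul, h1, ← Measure.restrict_restrict_of_subset hx,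
    integral_congr_ae (ae_restrict_of_ae h)]

/-- A bounded sequence in `BV` whose means over small balls converge is Cauchy in `L¹` of compact
subsets. -/
lemma exists_setIntegral_abs_sub_le {u : ℕ → EuclideanSpace ℝ (Fin d) → ℝ} (hΩ : IsOpen Ω)
    (hC : 0 ≤ C) (hu : ∀ n, Measurable (u n)) (huB : ∀ n x, |u n x| ≤ B)
    (huC : ∀ n, totalVariation Ω (u n) ≤ ENNReal.ofReal C)
    (hmean : ∀ x r, 0 < r → Metric.ball x r ⊆ Ω →
      ∃ l, Tendsto (fun n => ballMean r (u n) x) atTop (𝓝 l))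
    {K : Set (EuclideanSpace ℝ (Fin d))} (hK : IsCompact K) (hKΩ : K ⊆ Ω) {ε : ℝ} (hε : 0 < ε) :
    ∃ N, ∀ m ≥ N, ∀ n ≥ N, ∫ x in K, |u m x - u n x| ≤ ε := by
  obtain ⟨δ, hδ, hδΩ⟩ := hK.exists_cthickening_subset_open hΩ hKΩ
  -- A third of `ε` goes to each replacement of a function by its means, a third to the difference
  -- of the means.
  obtain ⟨r, hr, hrδ, hrC⟩ : ∃ r : ℝ, 0 < r ∧ r + r ≤ δ ∧ r * C ≤ ε / 3 := by
    refine ⟨min (δ / 2) (ε / 3 / (C + 1)), by positivity, ?_, ?_⟩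
    · linarith [min_le_left (δ / 2) (ε / 3 / (C + 1))]
    · calc min (δ / 2) (ε / 3 / (C + 1)) * C ≤ ε / 3 / (C + 1) * (C + 1) := by
            gcongr
            · exact min_le_right _ _
            · linarith
        _ = ε / 3 := div_mul_cancel₀ _ (by positivity)
  have hKr : Metric.cthickening (r + r) K ⊆ Ω := (Metric.cthickening_mono hrδ K).trans hδΩ
  have hfin : IsFiniteMeasure (volume.restrict K) := ⟨by simpa using hK.measure_lt_top⟩
  have hM : ∀ n, Measurable (ballMean r (u n)) := fun n => ballMean_measurable (hu n)
  have hMB : ∀ n x, |ballMean r (u n) x| ≤ B := fun n x => abs_ballMean_le hr (huB n) x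
  have hlim : Tendsto (fun p : ℕ × ℕ =>
      ∫ x in K, |ballMean r (u p.1) x - ballMean r (u p.2) x|) (atTop ×ˢ atTop)
      (𝓝 (∫ x in K, (0 : ℝ))) := by
    refine tendsto_integral_filter_of_dominated_convergence (fun _ => B + B)
      (Eventually.of_forall fun p => ((hM p.1).sub (hM p.2)).abs.aestronglyMeasurable)
      (Eventually.of_forall fun p => ae_of_all _ fun x => ?_) (integrable_const _) ?_
    · rw [Real.norm_eq_abs, abs_abs]
      exact (abs_sub _ _).trans (add_le_add (hMB _ _) (hMB _ _))
    · filter_upwards [ae_restrict_mem hK.measurableSet] with x hx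
      obtain ⟨l, hl⟩ := hmean x r hr (Metric.ball_subset_closedBall.trans
        ((Metric.closedBall_subset_cthickening hx r).trans
          ((Metric.cthickening_mono (by linarith) K).trans hKr)))
      simpa using ((hl.comp tendsto_fst).sub (hl.comp tendsto_snd)).abs
  rw [integral_zero, prod_atTop_atTop_eq] at hlim
  obtain ⟨⟨N₁, N₂⟩, hN⟩ := eventually_atTop.1 (hlim.eventually (gt_mem_nhds (by positivity :
    (0 : ℝ) < ε / 3)))
  refine ⟨max N₁ N₂, fun m hm n hn => ?_⟩
  have hmn := hN (m, n) ⟨(le_max_left _ _).trans hm, (le_max_right _ _).trans hn⟩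
  have hint : ∀ f g : EuclideanSpace ℝ (Fin d) → ℝ, Measurable f → Measurable g →
      (∀ x, |f x| ≤ B) → (∀ x, |g x| ≤ B) → Integrable (fun x => |f x - g x|)
        (volume.restrict K) := fun f g hf hg hfB hgB =>
    Integrable.of_bound (hf.sub hg).abs.aestronglyMeasurable (B + B) (ae_of_all _ fun x => by
      rw [Real.norm_eq_abs, abs_abs]
      exact (abs_sub _ _).trans (add_le_add (hfB _) (hgB _)))
  have i1 := hint _ _ (hu m) (hM m) (huB m) (hMB m)
  have i2 := hint _ _ (hM m) (hM n) (hMB m) (hMB n)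
  have i3 := hint _ _ (hu n) (hM n) (huB n) (hMB n)
  have i12 : Integrable (fun x => |u m x - ballMean r (u m) x| +
    |ballMean r (u m) x - ballMean r (u n) x|) (volume.restrict K) := i1.add i2
  have e1 := setIntegral_abs_sub_ballMean_le hC (hu m) (huB m) (huC m) hr hK hKr
  have e3 := setIntegral_abs_sub_ballMean_le hC (hu n) (huB n) (huC n) hr hK hKr
  calc ∫ x in K, |u m x - u n x|
      ≤ ∫ x in K, (|u m x - ballMean r (u m) x| + |ballMean r (u m) x - ballMean r (u n) x|
          + |u n x - ballMean r (u n) x|) := by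
        refine integral_mono (hint _ _ (hu m) (hu n) (huB m) (huB n)) ((i1.add i2).add i3)
          fun x => ?_
        have t1 := abs_sub_le (u m x) (ballMean r (u m) x) (u n x)
        have t2 := abs_sub_le (ballMean r (u m) x) (ballMean r (u n) x) (u n x)
        have t3 := abs_sub_comm (u n x) (ballMean r (u n) x)
        dsimp only
        linarith
    _ = (∫ x in K, |u m x - ballMean r (u m) x|)
        + (∫ x in K, |ballMean r (u m) x - ballMean r (u n) x|)
        + ∫ x in K, |u n x - ballMean r (u n) x| := by
        rw [integral_add i12 i3, integral_add i1 i2]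
    _ ≤ ε := by linarith

/-- Since `|f - g| ≤ B + B`, the square is dominated by `(B + B) * |f - g|`; off `K` the same bound
is used once more. -/
lemma norm_sub_sq_le {v w : Lp ℝ 2 (volume.restrict Ω)} (hB : 0 ≤ B) (hΩ : MeasurableSet Ω)
    (hfin : volume Ω ≠ ∞)
    {f g : EuclideanSpace ℝ (Fin d) → ℝ} (hf : Measurable f) (hg : Measurable g)
    (hfB : ∀ x, |f x| ≤ B) (hgB : ∀ x, |g x| ≤ B) (hfv : f =ᵐ[volume.restrict Ω] v)
    (hgw : g =ᵐ[volume.restrict Ω] w) {K : Set (EuclideanSpace ℝ (Fin d))}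
    (hK : MeasurableSet K) (hKΩ : K ⊆ Ω) :
    ‖v - w‖ ^ 2 ≤ (B + B) * (∫ x in K, |f x - g x|) + (B + B) ^ 2 * volume.real (Ω \ K) := by
  have : IsFiniteMeasure (volume.restrict Ω) := ⟨by simpa using hfin.lt_top⟩
  have hb : ∀ x, |f x - g x| ≤ B + B := fun x =>
    (abs_sub _ _).trans (add_le_add (hfB _) (hgB _))
  have hi : IntegrableOn (fun x => |f x - g x|) Ω :=
    Integrable.of_bound (hf.sub hg).abs.aestronglyMeasurable (B + B) (ae_of_all _ fun x => by
      rw [Real.norm_eq_abs, abs_abs]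
      exact hb x)
  have hsq : ‖v - w‖ ^ 2 = ∫ x in Ω, |f x - g x| ^ 2 := by
    rw [← real_inner_self_eq_norm_sq, L2.inner_def]
    refine integral_congr_ae ?_
    filter_upwards [Lp.coeFn_sub v w, hfv, hgw] with x h1 h2 h3
    rw [h1, Pi.sub_apply, ← h2, ← h3, real_inner_self_eq_norm_sq, Real.norm_eq_abs]
  have hsplit : ∫ x in Ω, |f x - g x| = (∫ x in K, |f x - g x|) + ∫ x in Ω \ K, |f x - g x| := by
    rw [← setIntegral_union disjoint_sdiff_right (hΩ.diff hK) (hi.mono_set hKΩ)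
      (hi.mono_set sdiff_subset), union_sdiff_cancel hKΩ]
  have hrest : ∫ x in Ω \ K, |f x - g x| ≤ (B + B) * volume.real (Ω \ K) := by
    have := norm_setIntegral_le_of_norm_le_const (μ := volume) (s := Ω \ K) (C := B + B)
      (f := fun x => |f x - g x|) ((measure_mono sdiff_subset).trans_lt hfin.lt_top)
      (fun x _ => by rw [Real.norm_eq_abs, abs_abs]; exact hb x)
    exact (le_abs_self _).trans this
  calc ‖v - w‖ ^ 2 = ∫ x in Ω, |f x - g x| ^ 2 := hsq
    _ ≤ ∫ x in Ω, (B + B) * |f x - g x| := by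
        refine integral_mono_of_nonneg (ae_of_all _ fun x => sq_nonneg _) (hi.const_mul _)
          (ae_of_all _ fun x => ?_)
        simp only [sq]
        exact mul_le_mul_of_nonneg_right (hb x) (abs_nonneg _)
    _ = (B + B) * ((∫ x in K, |f x - g x|) + ∫ x in Ω \ K, |f x - g x|) := by
        rw [integral_const_mul, hsplit]
    _ ≤ _ := by
        rw [mul_add, sq, mul_assoc (B + B) (B + B)]
        gcongr

lemma norm_le_of_ae_mem_Icc (hB : 0 ≤ B) (hfin : volume Ω ≠ ∞)
    {v : Lp ℝ 2 (volume.restrict Ω)} (hv : ∀ᵐ x ∂(volume.restrict Ω), v x ∈ Icc (-B) B) :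
    ‖v‖ ≤ (volume.real Ω) ^ (1 / 2 : ℝ) * B := by
  have : IsFiniteMeasure (volume.restrict Ω) := ⟨by simpa using hfin.lt_top⟩
  have := Lp.norm_le_of_ae_bound (f := v) (C := B) hB (hv.mono fun x hx => abs_le.2 hx)
  simpa [measureUnivNNReal, Measure.real, ENNReal.coe_toNNReal_eq_toReal] using this

/-- Compactness of bounded sets in `BV`, for uniformly bounded functions on a bounded open set
without regularity of its boundary. -/
theorem isCompact_bvBall (hΩ : IsOpen Ω) (hfin : volume Ω ≠ ∞) (hB : 0 ≤ B) (hC : 0 ≤ C) :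
    IsCompact (bvBall Ω B C) := by
  have : Fact ((2 : ℝ≥0∞) ≠ ∞) := ⟨ENNReal.ofNat_ne_top⟩
  refine IsSeqCompact.isCompact fun v hv => ?_
  obtain ⟨k, hk, hweak⟩ := exists_subseq_tendsto_inner
    (fun n => norm_le_of_ae_mem_Icc hB hfin (hv n).1)
  choose u hu huB huC huv using fun n => exists_measurable_representative hB (hv (k n))
  have hmean : ∀ x r, 0 < r → Metric.ball x r ⊆ Ω →
      ∃ l, Tendsto (fun n => ballMean r (u n) x) atTop (𝓝 l) := by
    intro x r hr hx
    have hμ : volume.restrict Ω (Metric.ball x r) ≠ ∞ :=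
      ((Measure.restrict_apply_le _ _).trans_lt measure_ball_lt_top).ne
    obtain ⟨l, hl⟩ := hweak (indicatorConstLp 2 Metric.isOpen_ball.measurableSet hμ 1)
    refine ⟨_, (hl.const_mul (volume.real (Metric.ball (0 : EuclideanSpace ℝ (Fin d)) r))⁻¹).congr
      fun n => ?_⟩
    rw [ballMean_eq_setIntegral hx (huv n), real_inner_comm, L2.inner_indicatorConstLp_one]
  have hcauchy : CauchySeq fun n => v (k n) := by
    refine Metric.cauchySeq_iff.2 fun η hη => ?_
    set D := B + B with hD
    have hD0 : 0 ≤ D := by positivity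
    -- The final estimate is `(D + D ^ 2) * ε`; the `+ 1` makes it strictly less than `η ^ 2`.
    set ε := η ^ 2 / (D + D ^ 2 + 1) with hε
    have hε0 : 0 < ε := by positivity
    obtain ⟨K, hKΩ, hK, hKε⟩ := hΩ.measurableSet.exists_isCompact_sdiff_lt hfin
      (ENNReal.ofReal_pos.2 hε0).ne'
    have hKε' : volume.real (Ω \ K) ≤ ε := ENNReal.toReal_le_of_le_ofReal hε0.le hKε.le
    obtain ⟨N, hN⟩ := exists_setIntegral_abs_sub_le hΩ hC hu huB huC hmean hK hKΩ hε0
    refine ⟨N, fun m hm n hn => ?_⟩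
    rw [dist_eq_norm]
    refine lt_of_pow_lt_pow_left₀ 2 hη.le ?_
    calc ‖v (k m) - v (k n)‖ ^ 2
        ≤ D * (∫ x in K, |u m x - u n x|) + D ^ 2 * volume.real (Ω \ K) :=
          norm_sub_sq_le hB hΩ.measurableSet hfin (hu m) (hu n) (huB m) (huB n) (huv m) (huv n)
            hK.measurableSet hKΩ
      _ ≤ D * ε + D ^ 2 * ε := by
          gcongr
          exact hN m hm n hn
      _ < (D + D ^ 2 + 1) * ε := by linarith
      _ = η ^ 2 := mul_div_cancel₀ _ (by positivity)
  obtain ⟨w, hw⟩ := cauchySeq_tendsto_of_complete hcauchy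
  exact ⟨w, isClosed_bvBall.mem_of_tendsto hw (Eventually.of_forall fun n => hv (k n)), k, hk, hw⟩

end BoundedVariation

/-! ### Constraints and objective of the subproblem -/

section TrustRegion

open Filter
open scoped Topology

variable {d M : ℕ} {Ω : Set (EuclideanSpace ℝ (Fin d))} {ν : Fin M → ℤ} {α : ℝ}

lemma isClosed_controlFeasible : IsClosed (controlFeasible Ω ν) := by
  have hT : IsClosed {y : ℝ | ∃ i : Fin M, y = ν i} := by
    simpa only [range, eq_comm] using
      (Set.finite_range fun i : Fin M => (ν i : ℝ)).isClosed
  exact isClosed_setOf_ae_mem hT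

lemma isClosed_trFeasible (v' : Lp ℝ 2 (volume.restrict Ω)) (Δ : ℝ) :
    IsClosed (trFeasible Ω ν v' Δ) :=
  (isClosed_setOf_eLpNorm_sub_le 1 v' _).inter isClosed_controlFeasible

lemma ae_mem_Icc_of_mem_controlFeasible {v : Lp ℝ 2 (volume.restrict Ω)}
    (hv : v ∈ controlFeasible Ω ν) :
    ∀ᵐ x ∂(volume.restrict Ω), v x ∈ Icc (-∑ i, |(ν i : ℝ)|) (∑ i, |(ν i : ℝ)|) := by
  filter_upwards [hv] with x ⟨i, hi⟩
  rw [hi]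
  exact abs_le.1 (Finset.single_le_sum (f := fun i => |(ν i : ℝ)|)
    (fun j _ => abs_nonneg _) (Finset.mem_univ i))

lemma trObjective_eq_coe {v' g v : Lp ℝ 2 (volume.restrict Ω)}
    (hv' : totalVariation Ω v' ≠ ∞) (hv : totalVariation Ω v ≠ ∞) :
    trObjective Ω α v' g v = ((inner ℝ g (v - v') + α * (totalVariation Ω v).toReal
      - α * (totalVariation Ω v').toReal : ℝ) : EReal) := by
  rw [trObjective, ← EReal.coe_ennreal_toReal hv, ← EReal.coe_ennreal_toReal hv']
  norm_cast

lemma trObjective_eq_top (hα : 0 < α) {v' g v : Lp ℝ 2 (volume.restrict Ω)}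
    (hv' : totalVariation Ω v' ≠ ∞) (hv : totalVariation Ω v = ∞) :
    trObjective Ω α v' g v = ⊤ := by
  rw [trObjective, hv, ← EReal.coe_ennreal_toReal hv', EReal.coe_ennreal_top,
    EReal.coe_mul_top_of_pos hα, EReal.coe_add_top, ← EReal.coe_mul, EReal.top_sub_coe]

/-- Finiteness on `s` is essential because `toReal` sends `∞` to `0`. -/
lemma lowerSemicontinuousOn_toReal {X : Type*} [TopologicalSpace X] {f : X → ℝ≥0∞} {s : Set X}
    (hf : LowerSemicontinuousOn f s) (hs : ∀ x ∈ s, f x ≠ ∞) :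
    LowerSemicontinuousOn (fun x => (f x).toReal) s := by
  intro x hx y hy
  rcases lt_or_ge y 0 with h0 | h0
  · exact Eventually.of_forall fun z => h0.trans_le ENNReal.toReal_nonneg
  · filter_upwards [hf x hx _ ((ENNReal.ofReal_lt_iff_lt_toReal h0 (hs x hx)).2 hy),
      self_mem_nhdsWithin] with z hz hzs
    exact (ENNReal.ofReal_lt_iff_lt_toReal h0 (hs z hzs)).1 hz

end TrustRegion

theorem proposition3p1 {d M : ℕ} (hd : 1 ≤ d) (hM : 1 ≤ M)
    (Ω : Set (EuclideanSpace ℝ (Fin d))) (hΩo : IsOpen Ω) (hΩc : IsConnected Ω)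
    (hΩb : Bornology.IsBounded Ω)
    (α : ℝ) (hα : 0 < α) (ν : Fin M → ℤ) (hν : StrictMono ν)
    (v' g : Lp ℝ 2 (volume.restrict Ω)) (hv' : v' ∈ controlFeasible Ω ν) (hBV : MemBV Ω v')
    (Δ : ℝ) (hΔ : 0 < Δ) :
    ∃ v ∈ trFeasible Ω ν v' Δ, IsMinOn (trObjective Ω α v' g) (trFeasible Ω ν v' Δ) v := by
  have hfin : volume Ω ≠ ∞ := hΩb.measure_lt_top.ne
  have hTV' : totalVariation Ω v' ≠ ∞ := hBV.2.ne
  set B : ℝ := ∑ i, |(ν i : ℝ)|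
  have hB : 0 ≤ B := Finset.sum_nonneg fun i _ => abs_nonneg _
  set R : ℝ := (volume.real Ω) ^ (1 / 2 : ℝ) * B
  have hR : 0 ≤ R := by positivity
  have hnorm : ∀ v ∈ controlFeasible Ω ν, ‖v‖ ≤ R := fun v hv =>
    norm_le_of_ae_mem_Icc hB hfin (ae_mem_Icc_of_mem_controlFeasible hv)
  -- The linear term is at least `-‖g‖ * (R + R)`, so beyond this `C` the gain in `α * TV` outweighs
  -- it.
  set C : ℝ := (totalVariation Ω v').toReal + ‖g‖ * (R + R) / α with hCdef
  have hC' : (totalVariation Ω v').toReal ≤ C := le_add_of_nonneg_right (by positivity)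
  have hC : 0 ≤ C := ENNReal.toReal_nonneg.trans hC'
  set S : Set (Lp ℝ 2 (volume.restrict Ω)) := bvBall Ω B C ∩ trFeasible Ω ν v' Δ
  have hS : IsCompact S := (isCompact_bvBall hΩo hfin hB hC).inter_right (isClosed_trFeasible v' Δ)
  have hv'S : v' ∈ S := by
    refine ⟨⟨ae_mem_Icc_of_mem_controlFeasible hv', ?_⟩, ?_, hv'⟩
    · exact (ENNReal.ofReal_toReal hTV').symm.trans_le (ENNReal.ofReal_le_ofReal hC')
    · simp
  have hSTV : ∀ v ∈ S, totalVariation Ω v ≠ ∞ := fun v hv =>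
    (hv.1.2.trans_lt ENNReal.ofReal_lt_top).ne
  have hlsc : LowerSemicontinuousOn (fun v : Lp ℝ 2 (volume.restrict Ω) =>
      inner ℝ g (v - v') + α * (totalVariation Ω v).toReal) S := by
    refine LowerSemicontinuousOn.add ?_ ?_
    · exact (by fun_prop : Continuous fun v : Lp ℝ 2 (volume.restrict Ω) =>
        inner ℝ g (v - v')).lowerSemicontinuous.lowerSemicontinuousOn S
    · exact (continuous_const_mul α).comp_lowerSemicontinuousOn
        (lowerSemicontinuousOn_toReal
          (lowerSemicontinuous_totalVariation.lowerSemicontinuousOn S) hSTV)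
        (monotone_mul_left_of_nonneg hα.le)
  obtain ⟨v, hvS, hmin⟩ := hlsc.exists_isMinOn ⟨v', hv'S⟩ hS
  refine ⟨v, hvS.2, fun w hw => ?_⟩
  rw [mem_ofPred_eq]
  by_cases hwtop : totalVariation Ω w = ∞
  · rw [trObjective_eq_top hα hTV' hwtop]
    exact le_top
  rw [trObjective_eq_coe hTV' (hSTV v hvS), trObjective_eq_coe hTV' hwtop, EReal.coe_le_coe_iff]
  refine sub_le_sub_right ?_ _
  by_cases hwC : totalVariation Ω w ≤ ENNReal.ofReal C
  · exact hmin ⟨⟨ae_mem_Icc_of_mem_controlFeasible hw.2, hwC⟩, hw⟩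
  -- For such `w` the objective is at least its value at `v'`, which belongs to `S` and is no better
  -- than `v`.
  have hCw : C ≤ (totalVariation Ω w).toReal :=
    ((ENNReal.ofReal_lt_iff_lt_toReal hC hwtop).1 (not_le.1 hwC)).le
  have h1 : inner ℝ g (v - v') + α * (totalVariation Ω v).toReal ≤
      α * (totalVariation Ω v').toReal := by
    simpa using hmin hv'S
  have h2 : -(‖g‖ * (R + R)) ≤ inner ℝ g (w - v') :=
    neg_le_of_abs_le ((abs_real_inner_le_norm _ _).trans (mul_le_mul_of_nonneg_left
      ((norm_sub_le _ _).trans (add_le_add (hnorm w hw.2) (hnorm v' hv'))) (norm_nonneg _)))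
  have h3 : α * C = α * (totalVariation Ω v').toReal + ‖g‖ * (R + R) := by
    rw [hCdef, mul_add, mul_div_cancel₀ _ hα.ne']
  have h4 : α * C ≤ α * (totalVariation Ω w).toReal := mul_le_mul_of_nonneg_left hCw hα.le
  linarith
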